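/- A measure $\mu$ on $[0,\infty)$ is called log-concave if it is either a non-negative multiple of a Dirac measure at a point of $[0,\infty)$, or absolutely continuous with a log-concave density $f:[0,\infty)\to\mathbb{R}$, i.e. $f\ge 0$ and $f(\lambda x+(1-\lambda)y)\ge f(x)^{\lambda}f(y)^{1-\lambda}$ for all $x,y\in[0,\infty)$ and $0<\lambda<1$. Let $k\le \ell\le m\le n$ be non-negative integers with $k+n=\ell+m$. For a finite log-concave measure $\mu$ on $[0,\infty)$, write $$a_t^{\mu}(j)=\int_0^\infty \frac{x^j}{j!}e^{-tx}\,d\mu(x)\qquad(t>0,\ j\ge 0).$$ A Berwald–Borell transform of $\mu$ with parameters $(k,\ell,m,n)$ is a finite non-negative Borel measure $\nu$ on $[0,\infty)$ such that $$\int_0^\infty e^{-tx}\,d\nu(x)=a_t^{\mu}(\ell)\,a_t^{\mu}(m)-a_t^{\mu}(k)\,a_t^{\mu}(n)\qquad\text{for all }t>0.$$ For a measure $\mu$ on $[0,\infty)$, let $P_j(\mu)$ be the measure with density $x\mapsto x^j/j!$ with respect to $\mu$, and, for $t\in\mathbb{R}$, let $E_t(\mu)$ be the measure with density $x\mapsto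 e^{-tx}$ with respect to $\mu$. **Corollary.** Let $\mu$ be a finite log-concave measure on $[0,\infty)$ and let $k\le\ell\le m\le n$ be non-negative integers with $k+n=\ell+m$. Then $\mu$ has exactly one Berwald–Borell transform $\nu$ with parameters $(k,\ell,m,n)$, and: (i) The measures $P_\ell(\mu)*P_m(\mu)$ and $P_k(\mu)*P_n(\mu)$ are finite, and $\nu=P_\ell(\mu)*P_m(\mu)-P_k(\mu)*P_n(\mu)$ as signed measures, where $*$ denotes convolution. (ii) For every $t>0$, the measure $E_t(\mu)$ is finite and log-concave and $E_t(\nu)$ is the Berwald–Borell transform of $E_t(\mu)$ with the same parameters $(k,\ell,m,n)$. The same holds for every $t\in\mathbb{R}$ for which $E_t(\mu)$ is a finite measure. -/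

import Mathlib

open MeasureTheory Set
open scoped ENNReal NNReal

/-- `f` is log-concave on the set `K` (meant for convex `K`). -/
def LogConcaveOn (K : Set ℝ) (f : ℝ → ℝ) : Prop :=
  (∀ x ∈ K, 0 ≤ f x) ∧
    ∀ x ∈ K, ∀ y ∈ K, ∀ r : ℝ, 0 < r → r < 1 →
      f x ^ r * f y ^ (1 - r) ≤ f (r * x + (1 - r) * y)

/-- A measure on `[0, ∞)`, regarded as a measure on `ℝ` that does not charge `(-∞, 0)`,
is log-concave if it is a non-negative multiple of a Dirac measure at a point of `[0, ∞)`, or is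
absolutely continuous with a density on `[0, ∞)` that is a log-concave function. -/
def IsLogConcaveMeasure (μ : Measure ℝ) : Prop :=
  (∃ (c : ℝ≥0) (x₀ : ℝ), 0 ≤ x₀ ∧ μ = c • Measure.dirac x₀) ∨
    ∃ f : ℝ → ℝ, Measurable f ∧ LogConcaveOn (Ici 0) f ∧
      μ = (volume.restrict (Ici 0)).withDensity (fun x => ENNReal.ofReal (f x))

/-- `a_t(j) = ∫_[0, ∞) (x ^ j / j!) e^{-t x} dμ(x)`. -/
noncomputable def alternatingTaylorCoeff (μ : Measure ℝ) (t : ℝ) (j : ℕ) : ℝ :=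
  ∫ x in Ici 0, x ^ j / (j.factorial : ℝ) * Real.exp (-t * x) ∂μ

/-- `ν` is a Berwald-Borell transform, with parameters `(k, l, m, n)`, of the finite log-concave
measure `μ` on `[0, ∞)`. -/
structure IsBerwaldBorellTransform (k l m n : ℕ) (μ ν : Measure ℝ) : Prop where
  base_finite : IsFiniteMeasure μ
  base_logConcave : IsLogConcaveMeasure μ
  finite : IsFiniteMeasure ν
  supported : ν (Iio 0) = 0
  laplace_eq : ∀ t : ℝ, 0 < t →
    ∫ x in Ici 0, Real.exp (-t * x) ∂ν =
      alternatingTaylorCoeff μ t l * alternatingTaylorCoeff μ t m -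
        alternatingTaylorCoeff μ t k * alternatingTaylorCoeff μ t n

/-- `P_j(μ)`: the measure with density `x ↦ x ^ j / j!` with respect to the measure `μ`
on `[0, ∞)`. -/
noncomputable def powerWeighted (j : ℕ) (μ : Measure ℝ) : Measure ℝ :=
  μ.withDensity (fun x => ENNReal.ofReal (x ^ j / (j.factorial : ℝ)))

/-- `E_t(μ)`: the measure with density `x ↦ e^{-t x}` with respect to `μ`. -/
noncomputable def expTilt (t : ℝ) (μ : Measure ℝ) : Measure ℝ :=
  μ.withDensity (fun x => ENNReal.ofReal (Real.exp (-t * x)))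

/-! Each a_t(j) is the Laplace transform of P_j(μ), and products of Laplace transforms correspond to
convolutions. Injectivity of the Laplace transform (`measure_ext_of_laplace`) therefore turns the
defining equation of ν into the identity ν + P_k(μ) * P_n(μ) = P_l(μ) * P_m(μ) between finite
measures (`isBerwaldBorellTransform_iff`). Uniqueness and (i) follow by cancellation. For (ii), tilt
this identity: e^{-tx} is multiplicative, so tilting passes through convolutions, and it commutes
with P_j.

Existence amounts to P_k(μ) * P_n(μ) ≤ P_l(μ) * P_m(μ) (`powerWeighted_conv_le`), and one-unit moves
P_a * P_{b+1} ≤ P_{a+1} * P_b with a ≤ b suffice. For a density f, the convolution densities at s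
are integrals over [0, s] of f(x) f(s - x) against two beta kernels. This product is log-concave and
symmetric about s/2, so its superlevel sets are intervals centred at s/2; by the layer-cake formula
only such intervals need checking, and on them the difference of the kernels is an exact derivative.
Finiteness of all measures involved comes from exponential decay of integrable log-concave
densities. -/

theorem expTilt_expTilt (s t : ℝ) (μ : Measure ℝ) :
    expTilt s (expTilt t μ) = expTilt (s + t) μ := by
  unfold expTilt
  rw [← withDensity_mul _ (by fun_prop) (by fun_prop)]
  congr 1
  ext x
  rw [Pi.mul_apply, ← ENNReal.ofReal_mul (Real.exp_nonneg _), ← Real.exp_add]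
  congr 2
  ring

theorem expTilt_zero (μ : Measure ℝ) : expTilt 0 μ = μ := by
  simp [expTilt, ← Pi.one_def]

theorem expTilt_add_measure (t : ℝ) (μ ν : Measure ℝ) :
    expTilt t (μ + ν) = expTilt t μ + expTilt t ν :=
  withDensity_add_measure _ _ _

theorem expTilt_absolutelyContinuous (t : ℝ) (μ : Measure ℝ) : expTilt t μ ≪ μ :=
  withDensity_absolutelyContinuous _ _

theorem ae_nonneg_of_Iio_eq_zero {μ : Measure ℝ} (h : μ (Iio 0) = 0) : ∀ᵐ x ∂μ, 0 ≤ x := by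
  rw [ae_iff]
  simpa [Iio_def] using h

theorem isFiniteMeasure_expTilt {μ : Measure ℝ} [IsFiniteMeasure μ] (h : μ (Iio 0) = 0) {t : ℝ}
    (ht : 0 ≤ t) : IsFiniteMeasure (expTilt t μ) := by
  refine isFiniteMeasure_withDensity (ne_of_lt ?_)
  calc ∫⁻ x, ENNReal.ofReal (Real.exp (-t * x)) ∂μ ≤ ∫⁻ _, 1 ∂μ := by
        refine lintegral_mono_ae ?_
        filter_upwards [ae_nonneg_of_Iio_eq_zero h] with x hx
        rw [ENNReal.ofReal_le_one, Real.exp_le_one_iff]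
        nlinarith
    _ < ∞ := by simp

theorem integral_expTilt (t : ℝ) (μ : Measure ℝ) (g : ℝ → ℝ) :
    ∫ x, g x ∂(expTilt t μ) = ∫ x, Real.exp (-t * x) * g x ∂μ := by
  rw [expTilt, integral_withDensity_eq_integral_toReal_smul (by fun_prop) (by simp)]
  simp [ENNReal.toReal_ofReal (Real.exp_nonneg _)]

theorem restrict_Ici_eq_self {μ : Measure ℝ} (h : μ (Iio 0) = 0) : μ.restrict (Ici 0) = μ :=
  Measure.restrict_eq_self_of_ae_mem (ae_nonneg_of_Iio_eq_zero h)

/-! ### Uniqueness for Laplace transforms -/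

open BoundedContinuousFunction in
/-- The bounded continuous function `x ↦ e^{-x}` on `[0, ∞)`. -/
noncomputable def expNegBCF : ℝ≥0 →ᵇ ℝ :=
  BoundedContinuousFunction.ofNormedAddCommGroup (fun x : ℝ≥0 => Real.exp (-(x : ℝ)))
    (by fun_prop) 1 (fun x => by simp)

@[simp]
theorem expNegBCF_apply (x : ℝ≥0) : expNegBCF x = Real.exp (-(x : ℝ)) := rfl

open BoundedContinuousFunction in
/-- Polynomials in `e^{-x}`, as bounded continuous functions on `[0, ∞)`. -/
noncomputable def expNegPolynomials : StarSubalgebra ℝ (ℝ≥0 →ᵇ ℝ) where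
  toSubalgebra := Algebra.adjoin ℝ {expNegBCF}
  star_mem' := by
    intro a ha
    have : star a = a := by ext x; simp
    rwa [this]

open BoundedContinuousFunction in
/-- A finite measure on `[0, ∞)` is determined by the integrals of the powers of `e^{-x}`. -/
theorem nnreal_measure_ext_of_integral_exp {P P' : Measure ℝ≥0} [IsFiniteMeasure P]
    [IsFiniteMeasure P']
    (h : ∀ i : ℕ, ∫ x : ℝ≥0, Real.exp (-(x : ℝ)) ^ i ∂P = ∫ x : ℝ≥0, Real.exp (-(x : ℝ)) ^ i ∂P') :
    P = P' := by
  refine ext_of_forall_mem_subalgebra_integral_eq_of_pseudoEMetric_complete_countable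
    (𝕜 := ℝ) (A := expNegPolynomials) ?_ ?_
  · intro x y hxy
    refine ⟨expNegBCF, ⟨toContinuousMapStarₐ ℝ expNegBCF, ⟨expNegBCF, ?_, rfl⟩, rfl⟩, ?_⟩
    · exact Algebra.self_mem_adjoin_singleton ℝ expNegBCF
    · simpa using hxy
  · intro g hg
    have hg' : g ∈ Algebra.adjoin ℝ {expNegBCF} := hg
    rw [Algebra.adjoin_singleton_eq_range_aeval] at hg'
    obtain ⟨p, rfl⟩ := hg'
    suffices ∀ p : Polynomial ℝ, ∫ x, (Polynomial.aeval expNegBCF p : ℝ≥0 →ᵇ ℝ) x ∂P =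
      ∫ x, (Polynomial.aeval expNegBCF p : ℝ≥0 →ᵇ ℝ) x ∂P' from this p
    intro p
    induction p using Polynomial.induction_on' with
    | add p q hp hq =>
      simp only [map_add, BoundedContinuousFunction.coe_add, Pi.add_apply]
      rw [integral_add (BoundedContinuousFunction.integrable _ _)
          (BoundedContinuousFunction.integrable _ _),
        integral_add (BoundedContinuousFunction.integrable _ _)
          (BoundedContinuousFunction.integrable _ _), hp, hq]
    | monomial i c =>
      simp only [Polynomial.aeval_monomial, BoundedContinuousFunction.coe_mul, Pi.mul_apply,
        BoundedContinuousFunction.pow_apply, expNegBCF_apply,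
        BoundedContinuousFunction.algebraMap_apply, smul_eq_mul, mul_one]
      rw [integral_const_mul, integral_const_mul, h i]

/-- A finite measure on `[0, ∞)` is determined by its Laplace transform on `(0, ∞)`. -/
theorem measure_ext_of_laplace {ν ν' : Measure ℝ} [IsFiniteMeasure ν] [IsFiniteMeasure ν']
    (hν : ν (Iio 0) = 0) (hν' : ν' (Iio 0) = 0)
    (h : ∀ t : ℝ, 0 < t → ∫ x in Ici 0, Real.exp (-t * x) ∂ν = ∫ x in Ici 0, Real.exp (-t * x) ∂ν') :
    ν = ν' := by
  -- Tilting by e^{-x} shifts the i-th moment to the Laplace transform at i + 1, so the value at t =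
  -- 0, which is not assumed, is never needed.
  have := isFiniteMeasure_expTilt hν zero_le_one
  have := isFiniteMeasure_expTilt hν' zero_le_one
  have moments : ∀ ρ : Measure ℝ, ρ (Iio 0) = 0 → ∀ i : ℕ,
      ∫ x : ℝ≥0, Real.exp (-(x : ℝ)) ^ i ∂((expTilt 1 ρ).map Real.toNNReal) =
        ∫ x in Ici 0, Real.exp (-((i : ℝ) + 1) * x) ∂ρ := by
    intro ρ hρ i
    rw [integral_map (by fun_prop) (by fun_prop), integral_expTilt, restrict_Ici_eq_self hρ]
    refine integral_congr_ae ?_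
    filter_upwards [ae_nonneg_of_Iio_eq_zero hρ] with x hx
    rw [Real.coe_toNNReal x hx, ← Real.exp_nat_mul, ← Real.exp_add]
    congr 1
    ring
  have back : ∀ ρ : Measure ℝ, ρ (Iio 0) = 0 →
      ((expTilt 1 ρ).map Real.toNNReal).map ((↑) : ℝ≥0 → ℝ) = expTilt 1 ρ := by
    intro ρ hρ
    rw [Measure.map_map (by fun_prop) (by fun_prop)]
    conv_rhs => rw [← Measure.map_id (μ := expTilt 1 ρ)]
    refine Measure.map_congr ?_
    filter_upwards [(expTilt_absolutelyContinuous 1 ρ).ae_le (ae_nonneg_of_Iio_eq_zero hρ)]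
      with x hx
    simp [Real.coe_toNNReal x hx]
  have key : (expTilt 1 ν).map Real.toNNReal = (expTilt 1 ν').map Real.toNNReal := by
    refine nnreal_measure_ext_of_integral_exp fun i => ?_
    rw [moments ν hν, moments ν' hν']
    exact h _ (by positivity)
  have key' : expTilt 1 ν = expTilt 1 ν' := by rw [← back ν hν, key, back ν' hν']
  rw [← expTilt_zero ν, ← expTilt_zero ν', ← neg_add_cancel (1 : ℝ), ← expTilt_expTilt, key',
    expTilt_expTilt]

/-! ### Beta kernels on symmetric intervals -/

/-- The kernel `x^a (s - x)^b / (a! b!)`. -/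
noncomputable def betaKernel (s : ℝ) (a b : ℕ) (x : ℝ) : ℝ :=
  x ^ a / (a.factorial : ℝ) * ((s - x) ^ b / (b.factorial : ℝ))

theorem continuous_betaKernel (s : ℝ) (a b : ℕ) : Continuous (betaKernel s a b) := by
  unfold betaKernel
  fun_prop

theorem betaKernel_nonneg {s : ℝ} (a b : ℕ) {x : ℝ} (h0 : 0 ≤ x) (hs : x ≤ s) :
    0 ≤ betaKernel s a b x := by
  have : 0 ≤ s - x := sub_nonneg.2 hs
  unfold betaKernel
  positivity

theorem hasDerivAt_pow_div_factorial (a : ℕ) (x : ℝ) :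
    HasDerivAt (fun y : ℝ => y ^ (a + 1) / ((a + 1).factorial : ℝ)) (x ^ a / (a.factorial : ℝ)) x := by
  refine ((hasDerivAt_pow (a + 1) x).div_const ((a + 1).factorial : ℝ)).congr_deriv ?_
  rw [Nat.factorial_succ]
  push_cast
  have : (a.factorial : ℝ) ≠ 0 := by positivity
  field_simp

theorem hasDerivAt_betaKernel_succ_succ (s : ℝ) (a b : ℕ) (x : ℝ) :
    HasDerivAt (betaKernel s (a + 1) (b + 1))
      (betaKernel s a (b + 1) x - betaKernel s (a + 1) b x) x := by
  have h1 := hasDerivAt_pow_div_factorial a x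
  have h2 := (hasDerivAt_pow_div_factorial b (s - x)).comp x ((hasDerivAt_id x).const_sub s)
  refine (h1.mul h2).congr_deriv ?_
  simp only [betaKernel, Function.comp_apply]
  ring

theorem betaKernel_reflect_le {s c : ℝ} {a b : ℕ} (hab : a ≤ b) (hc : 0 ≤ c) (hcs : c ≤ s - c) :
    betaKernel s b a c ≤ betaKernel s a b c := by
  obtain ⟨d, rfl⟩ := Nat.exists_eq_add_of_le hab
  have h : c ^ d ≤ (s - c) ^ d := pow_le_pow_left₀ hc hcs d
  have h0 : 0 ≤ s - c := hc.trans hcs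
  have h1 : c ^ (a + d) * (s - c) ^ a ≤ c ^ a * (s - c) ^ (a + d) := by
    rw [pow_add, pow_add]
    nlinarith [mul_le_mul_of_nonneg_left h (mul_nonneg (pow_nonneg hc a) (pow_nonneg h0 a))]
  unfold betaKernel
  rw [div_mul_div_comm, div_mul_div_comm, mul_comm ((a + d).factorial : ℝ)]
  gcongr

theorem betaKernel_reflect (s x : ℝ) (a b : ℕ) :
    betaKernel s a b (s - x) = betaKernel s b a x := by
  unfold betaKernel
  rw [sub_sub_cancel, mul_comm]

/-- The difference of the integrands is the derivative of `betaKernel s (a + 1) (b + 1)`, so only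
the two endpoint values matter; reflection brings both to c, where c ≤ s - c favours the larger
power on s - c. -/
theorem intervalIntegral_betaKernel_le {s c : ℝ} {a b : ℕ} (hab : a ≤ b) (hc : 0 ≤ c)
    (hcs : c ≤ s - c) :
    ∫ x in c..(s - c), betaKernel s a (b + 1) x ≤ ∫ x in c..(s - c), betaKernel s (a + 1) b x := by
  have i1 := (continuous_betaKernel s a (b + 1)).intervalIntegrable (μ := volume) c (s - c)
  have i2 := (continuous_betaKernel s (a + 1) b).intervalIntegrable (μ := volume) c (s - c)
  rw [← sub_nonpos, ← intervalIntegral.integral_sub i1 i2,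
    intervalIntegral.integral_eq_sub_of_hasDerivAt
      (fun x _ => hasDerivAt_betaKernel_succ_succ s a b x) (i1.sub i2), betaKernel_reflect,
    sub_nonpos]
  exact betaKernel_reflect_le (by omega) hc hcs

theorem setLIntegral_Ioc_betaKernel {s c : ℝ} (a b : ℕ) (hc : 0 ≤ c) (hcs : c ≤ s - c) :
    ∫⁻ x in Ioc c (s - c), ENNReal.ofReal (betaKernel s a b x) =
      ENNReal.ofReal (∫ x in c..(s - c), betaKernel s a b x) := by
  rw [intervalIntegral.integral_of_le hcs, ofReal_integral_eq_lintegral_ofReal]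
  · exact (continuous_betaKernel s a b).integrableOn_Ioc
  · filter_upwards [ae_restrict_mem measurableSet_Ioc] with x hx
    exact betaKernel_nonneg a b (hc.trans hx.1.le) (by linarith [hx.2])

/-- A bounded interval symmetric about `s / 2` is almost equal to some `(c, s - c]`. -/
theorem exists_ae_eq_Ioc_of_symmetric {s : ℝ} {A : Set ℝ} (hA : A ⊆ Icc 0 s)
    (hconv : A.OrdConnected) (hsymm : ∀ x ∈ A, s - x ∈ A) (hne : A.Nonempty) :
    ∃ c, 0 ≤ c ∧ c ≤ s - c ∧ A =ᵐ[volume] Ioc c (s - c) := by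
  have hbdd : BddBelow A := ⟨0, fun x hx => (hA hx).1⟩
  have hlow : ∀ x ∈ A, sInf A ≤ x := fun x hx => csInf_le hbdd hx
  have hup : ∀ x ∈ A, x ≤ s - sInf A := fun x hx => by linarith [hlow _ (hsymm x hx)]
  have hsub : A ⊆ Icc (sInf A) (s - sInf A) := fun x hx => ⟨hlow x hx, hup x hx⟩
  have hsup : Ioo (sInf A) (s - sInf A) ⊆ A := by
    intro x hx
    obtain ⟨y, hy, hyx⟩ := exists_lt_of_csInf_lt hne hx.1
    -- By symmetry s - z lies in A and to the right of x, so x is caught between two points of A.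
    obtain ⟨z, hz, hzx⟩ := exists_lt_of_csInf_lt hne (show sInf A < s - x by linarith [hx.2])
    exact hconv.out hy (hsymm z hz) ⟨hyx.le, by linarith⟩
  obtain ⟨x, hx⟩ := hne
  refine ⟨sInf A, le_csInf ⟨x, hx⟩ fun y hy => (hA hy).1, (hlow x hx).trans (hup x hx), ?_⟩
  have h1 : A ≤ᵐ[volume] Ioc (sInf A) (s - sInf A) :=
    (hsub.eventuallyLE).trans Ioc_ae_eq_Icc.symm.le
  have h2 : Ioc (sInf A) (s - sInf A) ≤ᵐ[volume] A :=
    Ioo_ae_eq_Ioc.symm.le.trans hsup.eventuallyLE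
  exact h1.antisymm h2

theorem setLIntegral_betaKernel_le {s : ℝ} {a b : ℕ} (hab : a ≤ b) {A : Set ℝ} (hA : A ⊆ Icc 0 s)
    (hconv : A.OrdConnected) (hsymm : ∀ x ∈ A, s - x ∈ A) :
    ∫⁻ x in A, ENNReal.ofReal (betaKernel s a (b + 1) x) ≤
      ∫⁻ x in A, ENNReal.ofReal (betaKernel s (a + 1) b x) := by
  rcases A.eq_empty_or_nonempty with rfl | hne
  · simp
  obtain ⟨c, hc, hcs, hAc⟩ := exists_ae_eq_Ioc_of_symmetric hA hconv hsymm hne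
  rw [setLIntegral_congr hAc, setLIntegral_congr hAc, setLIntegral_Ioc_betaKernel a _ hc hcs,
    setLIntegral_Ioc_betaKernel _ b hc hcs]
  exact ENNReal.ofReal_le_ofReal (intervalIntegral_betaKernel_le hab hc hcs)

/-! ### Superlevel sets and the layer-cake reduction -/

theorem LogConcaveOn.min_le {K : Set ℝ} {f : ℝ → ℝ} (hf : LogConcaveOn K f) {x y r : ℝ}
    (hx : x ∈ K) (hy : y ∈ K) (hr : 0 < r) (hr1 : r < 1) :
    min (f x) (f y) ≤ f (r * x + (1 - r) * y) := by
  have h0 : 0 ≤ min (f x) (f y) := le_min (hf.1 x hx) (hf.1 y hy)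
  refine le_trans ?_ (hf.2 x hx y hy r hr hr1)
  calc min (f x) (f y) = min (f x) (f y) ^ r * min (f x) (f y) ^ (1 - r) := by
        rw [← Real.rpow_add_of_nonneg h0 hr.le (by linarith)]
        simp
    _ ≤ f x ^ r * f y ^ (1 - r) := by
        exact mul_le_mul (Real.rpow_le_rpow h0 (min_le_left _ _) hr.le)
          (Real.rpow_le_rpow h0 (min_le_right _ _) (by linarith)) (by positivity)
          (Real.rpow_nonneg (hf.1 x hx) _)

theorem LogConcaveOn.ordConnected_superlevel {a b : ℝ} {f : ℝ → ℝ} (hf : LogConcaveOn (Icc a b) f)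
    (t : ℝ) : ({x | t < f x} ∩ Icc a b).OrdConnected := by
  refine Set.ordConnected_of_Ioo fun x hx y hy _ z hz => ?_
  have hxy : 0 < y - x := by linarith [hz.1, hz.2]
  refine ⟨?_, hx.2.1.trans hz.1.le, hz.2.le.trans hy.2.2⟩
  have h := hf.min_le hx.2 hy.2 (r := (y - z) / (y - x)) (div_pos (by linarith [hz.2]) hxy)
    (by rw [div_lt_one hxy]; linarith [hz.1])
  have hz' : (y - z) / (y - x) * x + (1 - (y - z) / (y - x)) * y = z := by
    field_simp
    ring
  rw [hz'] at h
  exact lt_of_lt_of_le (lt_min hx.1 hy.1) h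

theorem LogConcaveOn.mul_reflect {f : ℝ → ℝ} (hf : LogConcaveOn (Ici 0) f) (s : ℝ) :
    LogConcaveOn (Icc 0 s) (fun x => f x * f (s - x)) := by
  have hs : ∀ x ∈ Icc 0 s, s - x ∈ Ici (0 : ℝ) := fun x hx => sub_nonneg.2 hx.2
  refine ⟨fun x hx => mul_nonneg (hf.1 x hx.1) (hf.1 _ (hs x hx)), fun x hx y hy r hr hr1 => ?_⟩
  have h1 := hf.2 x hx.1 y hy.1 r hr hr1
  have h2 := hf.2 _ (hs x hx) _ (hs y hy) r hr hr1
  have e : r * (s - x) + (1 - r) * (s - y) = s - (r * x + (1 - r) * y) := by ring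
  rw [e] at h2
  have p1 := hf.1 x hx.1
  have p2 := hf.1 y hy.1
  have p3 := hf.1 _ (hs x hx)
  have p4 := hf.1 _ (hs y hy)
  rw [Real.mul_rpow p1 p3, Real.mul_rpow p2 p4, mul_mul_mul_comm]
  exact mul_le_mul h1 h2 (by positivity) (le_trans (by positivity) h1)

/-- Layer-cake form of the integral of `h` against a beta kernel. -/
theorem lintegral_mul_betaKernel_eq {s : ℝ} {h : ℝ → ℝ} (hm : Measurable h)
    (h0 : ∀ x ∈ Icc 0 s, 0 ≤ h x) (a b : ℕ) :
    ∫⁻ x in Icc 0 s, ENNReal.ofReal (h x) * ENNReal.ofReal (betaKernel s a b x) =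
      ∫⁻ t in Ioi 0, ∫⁻ x in {x | t < h x} ∩ Icc 0 s, ENNReal.ofReal (betaKernel s a b x) := by
  have hk : Measurable fun x => ENNReal.ofReal (betaKernel s a b x) :=
    (continuous_betaKernel s a b).measurable.ennreal_ofReal
  have h1 : 0 ≤ᵐ[(volume.restrict (Icc 0 s)).withDensity
      fun x => ENNReal.ofReal (betaKernel s a b x)] h := by
    refine (withDensity_absolutelyContinuous _ _).ae_le ?_
    filter_upwards [ae_restrict_mem measurableSet_Icc] with x hx
    exact h0 x hx
  have h2 := lintegral_eq_lintegral_meas_lt _ h1 hm.aemeasurable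
  rw [lintegral_withDensity_eq_lintegral_mul _ hk hm.ennreal_ofReal] at h2
  simp only [Pi.mul_apply, mul_comm (ENNReal.ofReal (betaKernel s a b _))] at h2
  rw [h2]
  refine lintegral_congr fun t => ?_
  have hmt : MeasurableSet {x | t < h x} := measurableSet_lt measurable_const hm
  rw [withDensity_apply _ hmt, Measure.restrict_restrict hmt]

/-- After the layer-cake formula the comparison holds level by level: each superlevel set of x ↦ f x
* f (s - x) in [0, s] is order-connected by log-concavity and invariant under x ↦ s - x. -/
theorem LogConcaveOn.lintegral_betaKernel_le {f : ℝ → ℝ} (hf : LogConcaveOn (Ici 0) f)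
    (hm : Measurable f) (s : ℝ) {a b : ℕ} (hab : a ≤ b) :
    ∫⁻ x in Icc 0 s, ENNReal.ofReal (f x * f (s - x)) *
        ENNReal.ofReal (betaKernel s a (b + 1) x) ≤
      ∫⁻ x in Icc 0 s, ENNReal.ofReal (f x * f (s - x)) *
        ENNReal.ofReal (betaKernel s (a + 1) b x) := by
  have hh := hf.mul_reflect s
  have hhm : Measurable fun x => f x * f (s - x) := by fun_prop
  rw [lintegral_mul_betaKernel_eq hhm hh.1, lintegral_mul_betaKernel_eq hhm hh.1]
  refine lintegral_mono fun t => ?_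
  refine setLIntegral_betaKernel_le hab inter_subset_right (hh.ordConnected_superlevel t) ?_
  rintro x ⟨hx, hx0, hxs⟩
  refine ⟨?_, by linarith, by linarith⟩
  simpa [mul_comm] using hx

/-! ### The convolution inequality -/

theorem measurable_powerWeight (j : ℕ) :
    Measurable fun x : ℝ => ENNReal.ofReal (x ^ j / (j.factorial : ℝ)) := by fun_prop

theorem powerWeighted_withDensity_Ici {f : ℝ → ℝ} (hm : Measurable f) (j : ℕ) :
    powerWeighted j ((volume.restrict (Ici 0)).withDensity fun x => ENNReal.ofReal (f x)) =
      volume.withDensity ((Ici 0).indicator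
        fun x => ENNReal.ofReal (f x) * ENNReal.ofReal (x ^ j / (j.factorial : ℝ))) := by
  rw [withDensity_indicator measurableSet_Ici, powerWeighted,
    ← withDensity_mul _ hm.ennreal_ofReal (measurable_powerWeight j)]
  rfl

theorem lconvolution_indicator_eq {f : ℝ → ℝ} (h0 : ∀ x ∈ Ici 0, 0 ≤ f x) (a b : ℕ) (s : ℝ) :
    lconvolution ((Ici 0).indicator
        fun x => ENNReal.ofReal (f x) * ENNReal.ofReal (x ^ a / (a.factorial : ℝ)))
      ((Ici 0).indicator
        fun x => ENNReal.ofReal (f x) * ENNReal.ofReal (x ^ b / (b.factorial : ℝ))) volume s =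
    ∫⁻ x in Icc 0 s, ENNReal.ofReal (f x * f (s - x)) * ENNReal.ofReal (betaKernel s a b x) := by
  rw [lconvolution_def, ← lintegral_indicator measurableSet_Icc]
  refine lintegral_congr fun x => ?_
  by_cases hx : x ∈ Icc 0 s
  · have hx' : -x + s ∈ Ici (0 : ℝ) := by simpa using hx.2
    have hx0 : 0 ≤ x := hx.1
    rw [indicator_of_mem hx, indicator_of_mem (show x ∈ Ici (0 : ℝ) from hx.1),
      indicator_of_mem hx', neg_add_eq_sub, betaKernel, ENNReal.ofReal_mul (h0 x hx.1),
      ENNReal.ofReal_mul (by positivity)]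
    ring
  · rw [indicator_of_notMem hx]
    by_cases hx0 : 0 ≤ x
    · have : -x + s ∉ Ici (0 : ℝ) := fun h => hx ⟨hx0, by simpa using h⟩
      rw [indicator_of_notMem this, mul_zero]
    · rw [indicator_of_notMem (by simpa using hx0), zero_mul]

theorem powerWeighted_conv_le_succ_of_density {f : ℝ → ℝ} (hm : Measurable f)
    (hf : LogConcaveOn (Ici 0) f) {a b : ℕ} (hab : a ≤ b) {μ : Measure ℝ}
    (hμ : μ = (volume.restrict (Ici 0)).withDensity fun x => ENNReal.ofReal (f x)) :
    (powerWeighted a μ).conv (powerWeighted (b + 1) μ) ≤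
      (powerWeighted (a + 1) μ).conv (powerWeighted b μ) := by
  have hmeas : ∀ j : ℕ, Measurable ((Ici 0).indicator
      fun x => ENNReal.ofReal (f x) * ENNReal.ofReal (x ^ j / (j.factorial : ℝ))) := fun j =>
    (hm.ennreal_ofReal.mul (measurable_powerWeight j)).indicator measurableSet_Ici
  simp only [hμ, powerWeighted_withDensity_Ici hm]
  rw [conv_withDensity_eq_lconvolution (hmeas _) (hmeas _),
    conv_withDensity_eq_lconvolution (hmeas _) (hmeas _)]
  refine withDensity_mono (Filter.Eventually.of_forall fun s => ?_)
  rw [lconvolution_indicator_eq hf.1, lconvolution_indicator_eq hf.1]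
  exact hf.lintegral_betaKernel_le hm s hab

theorem powerWeighted_smul_dirac (j : ℕ) (c : ℝ≥0) (x₀ : ℝ) :
    powerWeighted j (c • Measure.dirac x₀) =
      ((c : ℝ≥0∞) * ENNReal.ofReal (x₀ ^ j / (j.factorial : ℝ))) • Measure.dirac x₀ := by
  have : c • Measure.dirac x₀ = (c : ℝ≥0∞) • Measure.dirac x₀ := rfl
  rw [powerWeighted, this, withDensity_smul_measure, dirac_withDensity, smul_smul]

/-- Both sides are multiples of one point mass with the same power of x₀, so the claim is (a + 1)!
b! ≤ a! (b + 1)!, that is, a ≤ b. -/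
theorem powerWeighted_conv_le_succ_of_dirac {c : ℝ≥0} {x₀ : ℝ} (hx : 0 ≤ x₀) {a b : ℕ}
    (hab : a ≤ b) {μ : Measure ℝ} (hμ : μ = c • Measure.dirac x₀) :
    (powerWeighted a μ).conv (powerWeighted (b + 1) μ) ≤
      (powerWeighted (a + 1) μ).conv (powerWeighted b μ) := by
  have key : x₀ ^ a / (a.factorial : ℝ) * (x₀ ^ (b + 1) / ((b + 1).factorial : ℝ)) ≤
      x₀ ^ (a + 1) / ((a + 1).factorial : ℝ) * (x₀ ^ b / (b.factorial : ℝ)) := by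
    have e1 : x₀ ^ a * x₀ ^ (b + 1) = x₀ ^ (a + 1) * x₀ ^ b := by ring
    rw [div_mul_div_comm, div_mul_div_comm, e1]
    refine div_le_div_of_nonneg_left (by positivity) (by positivity) ?_
    rw [Nat.factorial_succ, Nat.factorial_succ]
    norm_cast
    nlinarith [Nat.mul_le_mul_right (a.factorial * b.factorial) hab]
  simp only [hμ, powerWeighted_smul_dirac, Measure.conv_smul_left, Measure.conv_smul_right,
    smul_smul]
  refine Measure.le_iff.2 fun s _ => ?_
  simp only [Measure.smul_apply, smul_eq_mul]
  gcongr ?_ * _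
  rw [mul_mul_mul_comm, mul_mul_mul_comm (c : ℝ≥0∞) _ (c : ℝ≥0∞),
    ← ENNReal.ofReal_mul (by positivity), ← ENNReal.ofReal_mul (by positivity)]
  exact mul_le_mul' le_rfl (ENNReal.ofReal_le_ofReal (by linarith [key]))

theorem IsLogConcaveMeasure.powerWeighted_conv_le_succ {μ : Measure ℝ} (hμ : IsLogConcaveMeasure μ)
    {a b : ℕ} (hab : a ≤ b) :
    (powerWeighted a μ).conv (powerWeighted (b + 1) μ) ≤
      (powerWeighted (a + 1) μ).conv (powerWeighted b μ) := by
  rcases hμ with ⟨c, x₀, hx, hμ⟩ | ⟨f, hm, hf, hμ⟩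
  · exact powerWeighted_conv_le_succ_of_dirac hx hab hμ
  · exact powerWeighted_conv_le_succ_of_density hm hf hab hμ

theorem IsLogConcaveMeasure.powerWeighted_conv_le_add {μ : Measure ℝ} (hμ : IsLogConcaveMeasure μ)
    {a b d : ℕ} (h : a + d ≤ b) :
    (powerWeighted a μ).conv (powerWeighted (b + d) μ) ≤
      (powerWeighted (a + d) μ).conv (powerWeighted b μ) := by
  induction d generalizing a with
  | zero => exact le_rfl
  | succ d ih =>
    have h1 := hμ.powerWeighted_conv_le_succ (a := a) (b := b + d) (by omega)
    have h2 := ih (a := a + 1) (by omega)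
    rw [show a + 1 + d = a + (d + 1) by ring] at h2
    exact h1.trans h2

theorem IsLogConcaveMeasure.powerWeighted_conv_le {μ : Measure ℝ} (hμ : IsLogConcaveMeasure μ)
    {k l m n : ℕ} (hkl : k ≤ l) (hlm : l ≤ m) (hsum : k + n = l + m) :
    (powerWeighted k μ).conv (powerWeighted n μ) ≤
      (powerWeighted l μ).conv (powerWeighted m μ) := by
  obtain ⟨d, rfl⟩ := Nat.exists_eq_add_of_le hkl
  obtain rfl : n = m + d := by omega
  exact hμ.powerWeighted_conv_le_add hlm

/-! ### Exponential decay and finite moments -/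

/-- A log-concave function that is integrable on `[0, ∞)` decays exponentially. -/
theorem LogConcaveOn.exists_exp_decay {f : ℝ → ℝ} (hf : LogConcaveOn (Ici 0) f)
    (hint : ∫⁻ x in Ici 0, ENNReal.ofReal (f x) ≠ ∞) :
    ∃ b C ε : ℝ, 0 ≤ b ∧ 0 ≤ C ∧ 0 < ε ∧ ∀ x, b ≤ x → f x ≤ C * Real.exp (-ε * x) := by
  by_cases hz : ∀ x ∈ Ici (0 : ℝ), f x ≤ 0
  · exact ⟨0, 0, 1, le_rfl, le_rfl, one_pos, fun x hx => by simpa using hz x hx⟩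
  push Not at hz
  obtain ⟨a, ha, hfa⟩ := hz
  have ha0 : 0 ≤ a := ha
  obtain ⟨b, hab, hfb⟩ : ∃ b, a < b ∧ f b < f a := by
    by_contra! hcon
    refine hint (top_le_iff.1 ?_)
    calc (∞ : ℝ≥0∞) = ∫⁻ _ in Ioi a, ENNReal.ofReal (f a) := by
          simp [ENNReal.mul_top, hfa]
      _ ≤ ∫⁻ x in Ioi a, ENNReal.ofReal (f x) :=
          setLIntegral_mono' measurableSet_Ioi fun x hx => ENNReal.ofReal_le_ofReal (hcon x hx)
      _ ≤ ∫⁻ x in Ici 0, ENNReal.ofReal (f x) :=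
          lintegral_mono_set fun x hx => ha0.trans (le_of_lt hx)
  have hb0 : 0 ≤ f b := hf.1 b (ha0.trans hab.le)
  -- The ratio f b / f a may vanish; a slightly larger q keeps log q finite and negative.
  obtain ⟨q, hq0, hq1, hq⟩ : ∃ q, 0 < q ∧ q < 1 ∧ f b ≤ q * f a := by
    obtain ⟨y, hy1, hy2⟩ := exists_between hfb
    exact ⟨y / f a, div_pos (hb0.trans_lt hy1) hfa, (div_lt_one hfa).2 hy2,
      by rw [div_mul_cancel₀ _ hfa.ne']; exact hy1.le⟩
  have hlog : Real.log q < 0 := Real.log_neg hq0 hq1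
  have hba : 0 < b - a := sub_pos.2 hab
  -- The bound is f a * q ^ ((x - a) / (b - a)), the exponential through (a, f a) and (b, q * f a).
  -- Starting at b + 1 makes the weight w below strictly less than 1.
  refine ⟨b + 1, f a * Real.exp (-(Real.log q / (b - a)) * a), -(Real.log q / (b - a)),
    by linarith, by positivity, neg_pos.2 (div_neg_of_neg_of_pos hlog hba), fun x hx => ?_⟩
  have hxa : 0 < x - a := by linarith
  have hx0 : 0 ≤ f x := hf.1 x (show (0 : ℝ) ≤ x by linarith)
  set w : ℝ := (b - a) / (x - a) with hw
  have hw0 : 0 < w := div_pos hba hxa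
  have hw1 : w < 1 := by rw [hw, div_lt_one hxa]; linarith
  have hconc := hf.2 x (show (0 : ℝ) ≤ x by linarith) a ha w hw0 hw1
  have hpt : w * x + (1 - w) * a = b := by
    rw [hw]
    field_simp
    ring
  rw [hpt] at hconc
  have h1 : f x ^ w ≤ q * f a ^ w := by
    have hpos : 0 < f a ^ (1 - w) := Real.rpow_pos_of_pos hfa _
    refine le_of_mul_le_mul_right ?_ hpos
    calc f x ^ w * f a ^ (1 - w) ≤ q * f a := hconc.trans hq
      _ = q * f a ^ w * f a ^ (1 - w) := by
        rw [mul_assoc, ← Real.rpow_add hfa, add_sub_cancel, Real.rpow_one]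
  have h2 : f x ≤ q ^ (1 / w) * f a := by
    have := Real.rpow_le_rpow (Real.rpow_nonneg hx0 _) h1 (one_div_nonneg.2 hw0.le)
    rwa [Real.mul_rpow hq0.le (Real.rpow_nonneg hfa.le _), ← Real.rpow_mul hx0,
      ← Real.rpow_mul hfa.le, mul_one_div_cancel hw0.ne', Real.rpow_one, Real.rpow_one] at this
  refine h2.trans (le_of_eq ?_)
  rw [Real.rpow_def_of_pos hq0, mul_comm, mul_assoc, ← Real.exp_add]
  congr 2
  rw [hw]
  field_simp
  ring

theorem pow_div_factorial_le_exp_mul {ε x : ℝ} (hε : 0 < ε) (hx : 0 ≤ x) (j : ℕ) :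
    x ^ j / (j.factorial : ℝ) ≤ (ε ^ j)⁻¹ * Real.exp (ε * x) := by
  have h := Real.pow_div_factorial_le_exp (ε * x) (by positivity) j
  rw [mul_pow, mul_div_assoc] at h
  rwa [inv_mul_eq_div, le_div_iff₀' (by positivity)]

theorem LogConcaveOn.lintegral_moment_ne_top {f : ℝ → ℝ} (hf : LogConcaveOn (Ici 0) f)
    (hint : ∫⁻ x in Ici 0, ENNReal.ofReal (f x) ≠ ∞) (j : ℕ) :
    ∫⁻ x in Ici 0, ENNReal.ofReal (f x) * ENNReal.ofReal (x ^ j / (j.factorial : ℝ)) ≠ ∞ := by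
  obtain ⟨b, C, ε, hb, hC, hε, hdec⟩ := hf.exists_exp_decay hint
  -- Half of the decay rate absorbs x ^ j; the other half keeps the tail integrable.
  have hε2 : 0 < ε / 2 := half_pos hε
  have hbound : ∀ x ∈ Ici (0 : ℝ),
      ENNReal.ofReal (f x) * ENNReal.ofReal (x ^ j / (j.factorial : ℝ)) ≤
        ENNReal.ofReal (b ^ j / (j.factorial : ℝ)) * ENNReal.ofReal (f x) +
          ENNReal.ofReal (C * ((ε / 2) ^ j)⁻¹ * Real.exp (-(ε / 2) * x)) := by
    intro x hx
    have hx0 : (0 : ℝ) ≤ x := hx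
    rcases le_total x b with hxb | hxb
    · refine le_trans ?_ le_self_add
      rw [mul_comm]
      gcongr
    · refine le_trans ?_ le_add_self
      rw [← ENNReal.ofReal_mul (hf.1 x hx)]
      refine ENNReal.ofReal_le_ofReal ?_
      calc f x * (x ^ j / (j.factorial : ℝ))
          ≤ (C * Real.exp (-ε * x)) * (((ε / 2) ^ j)⁻¹ * Real.exp (ε / 2 * x)) :=
            mul_le_mul (hdec x hxb) (pow_div_factorial_le_exp_mul hε2 hx0 j) (by positivity)
              (by positivity)
        _ = C * ((ε / 2) ^ j)⁻¹ * Real.exp (-(ε / 2) * x) := by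
            rw [mul_mul_mul_comm, ← Real.exp_add]
            congr 2
            ring
  refine ne_top_of_le_ne_top ?_ (setLIntegral_mono' measurableSet_Ici hbound)
  rw [lintegral_add_right _ (by fun_prop), lintegral_const_mul' _ _ ENNReal.ofReal_ne_top]
  refine ENNReal.add_ne_top.2 ⟨ENNReal.mul_ne_top ENNReal.ofReal_ne_top hint, ?_⟩
  have hi : IntegrableOn (fun x : ℝ => C * ((ε / 2) ^ j)⁻¹ * Real.exp (-(ε / 2) * x)) (Ici 0) :=
    ((integrableOn_Ici_iff_integrableOn_Ioi).2 (exp_neg_integrableOn_Ioi 0 hε2)).const_mul _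
  exact hi.lintegral_lt_top.ne

theorem IsLogConcaveMeasure.isFiniteMeasure_powerWeighted {μ : Measure ℝ} [IsFiniteMeasure μ]
    (hμ : IsLogConcaveMeasure μ) (j : ℕ) : IsFiniteMeasure (powerWeighted j μ) := by
  refine isFiniteMeasure_withDensity ?_
  have hfin : μ univ ≠ ∞ := measure_ne_top μ univ
  rcases hμ with ⟨c, x₀, -, rfl⟩ | ⟨f, hm, hf, rfl⟩
  · have : c • Measure.dirac x₀ = (c : ℝ≥0∞) • Measure.dirac x₀ := rfl
    rw [this, lintegral_smul_measure, lintegral_dirac]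
    exact ENNReal.mul_ne_top ENNReal.coe_ne_top ENNReal.ofReal_ne_top
  · rw [withDensity_apply _ MeasurableSet.univ, Measure.restrict_univ] at hfin
    rw [lintegral_withDensity_eq_lintegral_mul _ hm.ennreal_ofReal (measurable_powerWeight j)]
    exact hf.lintegral_moment_ne_top hfin j

/-! ### Tilts and Laplace transforms of convolutions -/

theorem IsLogConcaveMeasure.Iio_eq_zero {μ : Measure ℝ} (hμ : IsLogConcaveMeasure μ) :
    μ (Iio 0) = 0 := by
  rcases hμ with ⟨c, x₀, hx, rfl⟩ | ⟨f, -, -, rfl⟩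
  · simp [hx]
  · refine withDensity_absolutelyContinuous _ _ ?_
    rw [Measure.restrict_apply measurableSet_Iio, Iio_inter_Ici, Ico_self, measure_empty]

theorem IsLogConcaveMeasure.expTilt {μ : Measure ℝ} (hμ : IsLogConcaveMeasure μ) (t : ℝ) :
    IsLogConcaveMeasure (expTilt t μ) := by
  rcases hμ with ⟨c, x₀, hx, rfl⟩ | ⟨f, hm, hf, rfl⟩
  · refine Or.inl ⟨c * (Real.exp (-t * x₀)).toNNReal, x₀, hx, ?_⟩
    have h1 : c • Measure.dirac x₀ = (c : ℝ≥0∞) • Measure.dirac x₀ := rfl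
    rw [_root_.expTilt, h1, withDensity_smul_measure, dirac_withDensity, smul_smul]
    rfl
  · refine Or.inr ⟨fun x => f x * Real.exp (-t * x), by fun_prop,
      ⟨fun x hx => mul_nonneg (hf.1 x hx) (Real.exp_nonneg _), fun x hx y hy r hr hr1 => ?_⟩, ?_⟩
    · have h := hf.2 x hx y hy r hr hr1
      have hx0 := hf.1 x hx
      have hy0 := hf.1 y hy
      dsimp only
      rw [Real.mul_rpow hx0 (Real.exp_nonneg _), Real.mul_rpow hy0 (Real.exp_nonneg _),
        mul_mul_mul_comm, ← Real.exp_mul, ← Real.exp_mul, ← Real.exp_add,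
        show -t * x * r + -t * y * (1 - r) = -t * (r * x + (1 - r) * y) by ring]
      exact mul_le_mul_of_nonneg_right h (Real.exp_nonneg _)
    · rw [_root_.expTilt, ← withDensity_mul _ hm.ennreal_ofReal (by fun_prop)]
      refine withDensity_congr_ae ?_
      filter_upwards [ae_restrict_mem measurableSet_Ici] with x hx
      rw [Pi.mul_apply, ← ENNReal.ofReal_mul (hf.1 x hx)]

theorem expTilt_powerWeighted (t : ℝ) (j : ℕ) (μ : Measure ℝ) :
    expTilt t (powerWeighted j μ) = powerWeighted j (expTilt t μ) := by
  unfold expTilt powerWeighted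
  rw [← withDensity_mul _ (measurable_powerWeight j) (by fun_prop),
    ← withDensity_mul _ (by fun_prop) (measurable_powerWeight j), mul_comm]

theorem expTilt_conv (t : ℝ) (α β : Measure ℝ) [IsFiniteMeasure α] [IsFiniteMeasure β] :
    expTilt t (α.conv β) = (expTilt t α).conv (expTilt t β) := by
  unfold expTilt
  refine Measure.ext_of_lintegral _ fun φ hφ => ?_
  rw [lintegral_withDensity_eq_lintegral_mul _ (by fun_prop) hφ,
    Measure.lintegral_conv (by fun_prop), Measure.lintegral_conv hφ,
    lintegral_withDensity_eq_lintegral_mul _ (by fun_prop)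
      (Measurable.lintegral_prod_right' (f := fun p : ℝ × ℝ => φ (p.1 + p.2)) (by fun_prop))]
  refine lintegral_congr fun x => ?_
  rw [Pi.mul_apply, lintegral_withDensity_eq_lintegral_mul _ (by fun_prop) (by fun_prop),
    ← lintegral_const_mul _ (by fun_prop)]
  refine lintegral_congr fun y => ?_
  rw [Pi.mul_apply, Pi.mul_apply, ← mul_assoc, ← ENNReal.ofReal_mul (Real.exp_nonneg _),
    ← Real.exp_add, mul_add]

theorem integral_exp_conv (t : ℝ) (α β : Measure ℝ) [IsFiniteMeasure α] [IsFiniteMeasure β] :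
    ∫ x, Real.exp (-t * x) ∂(α.conv β) =
      (∫ x, Real.exp (-t * x) ∂α) * ∫ x, Real.exp (-t * x) ∂β := by
  rw [Measure.conv, integral_map (by fun_prop) (by fun_prop), ← integral_prod_mul]
  simp only [mul_add, Real.exp_add]

theorem conv_Iio_eq_zero {α β : Measure ℝ} [SFinite β] (hα : α (Iio 0) = 0) (hβ : β (Iio 0) = 0) :
    (α.conv β) (Iio 0) = 0 := by
  rw [Measure.conv, Measure.map_apply (by fun_prop) measurableSet_Iio]
  refine measure_mono_null (t := Iio 0 ×ˢ univ ∪ univ ×ˢ Iio 0) ?_ ?_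
  · rintro ⟨x, y⟩ h
    by_contra! hc
    simp only [mem_union, mem_prod, mem_Iio, mem_univ, and_true, true_and, not_or, not_lt] at hc
    exact absurd (show x + y < 0 from h) (not_lt.2 (add_nonneg hc.1 hc.2))
  · simp [Measure.prod_prod, hα, hβ]

theorem alternatingTaylorCoeff_eq {μ : Measure ℝ} (h : μ (Iio 0) = 0) (t : ℝ) (j : ℕ) :
    alternatingTaylorCoeff μ t j = ∫ x, Real.exp (-t * x) ∂(powerWeighted j μ) := by
  rw [alternatingTaylorCoeff, restrict_Ici_eq_self h, powerWeighted,
    integral_withDensity_eq_integral_toReal_smul (measurable_powerWeight j) (by simp)]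
  refine integral_congr_ae ?_
  filter_upwards [ae_nonneg_of_Iio_eq_zero h] with x hx
  rw [ENNReal.toReal_ofReal (by positivity), smul_eq_mul]

theorem integrable_exp_neg_mul {μ : Measure ℝ} [IsFiniteMeasure μ] (h : μ (Iio 0) = 0) {t : ℝ}
    (ht : 0 ≤ t) : Integrable (fun x => Real.exp (-t * x)) μ := by
  refine Integrable.of_bound (by fun_prop) 1 ?_
  filter_upwards [ae_nonneg_of_Iio_eq_zero h] with x hx
  rw [Real.norm_of_nonneg (Real.exp_nonneg _), Real.exp_le_one_iff]
  nlinarith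

/-- The Laplace transform of `P_i(μ) * P_j(μ)` is `a_t(i) a_t(j)`. -/
theorem IsLogConcaveMeasure.laplace_conv {μ : Measure ℝ} [IsFiniteMeasure μ]
    (hμ : IsLogConcaveMeasure μ) (t : ℝ) (i j : ℕ) :
    ∫ x, Real.exp (-t * x) ∂((powerWeighted i μ).conv (powerWeighted j μ)) =
      alternatingTaylorCoeff μ t i * alternatingTaylorCoeff μ t j := by
  have := hμ.isFiniteMeasure_powerWeighted i
  have := hμ.isFiniteMeasure_powerWeighted j
  rw [integral_exp_conv, alternatingTaylorCoeff_eq hμ.Iio_eq_zero,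
    alternatingTaylorCoeff_eq hμ.Iio_eq_zero]

theorem IsLogConcaveMeasure.conv_Iio_eq_zero {μ : Measure ℝ} [IsFiniteMeasure μ]
    (hμ : IsLogConcaveMeasure μ) (i j : ℕ) :
    ((powerWeighted i μ).conv (powerWeighted j μ)) (Iio 0) = 0 := by
  have := hμ.isFiniteMeasure_powerWeighted j
  exact _root_.conv_Iio_eq_zero (withDensity_absolutelyContinuous _ _ hμ.Iio_eq_zero)
    (withDensity_absolutelyContinuous _ _ hμ.Iio_eq_zero)

theorem IsLogConcaveMeasure.isFiniteMeasure_conv {μ : Measure ℝ} [IsFiniteMeasure μ]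
    (hμ : IsLogConcaveMeasure μ) (i j : ℕ) :
    IsFiniteMeasure ((powerWeighted i μ).conv (powerWeighted j μ)) := by
  have := hμ.isFiniteMeasure_powerWeighted i
  have := hμ.isFiniteMeasure_powerWeighted j
  infer_instance

theorem IsLogConcaveMeasure.expTilt_conv {μ : Measure ℝ} [IsFiniteMeasure μ]
    (hμ : IsLogConcaveMeasure μ) (t : ℝ) (i j : ℕ) :
    _root_.expTilt t ((powerWeighted i μ).conv (powerWeighted j μ)) =
      (powerWeighted i (_root_.expTilt t μ)).conv (powerWeighted j (_root_.expTilt t μ)) := by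
  have := hμ.isFiniteMeasure_powerWeighted i
  have := hμ.isFiniteMeasure_powerWeighted j
  rw [_root_.expTilt_conv, expTilt_powerWeighted, expTilt_powerWeighted]

/-! ### Characterisation and conclusion -/

/-- The Berwald-Borell transform is characterised by `ν + P_k(μ) * P_n(μ) = P_l(μ) * P_m(μ)`. -/
theorem isBerwaldBorellTransform_iff {μ ν : Measure ℝ} [IsFiniteMeasure μ]
    (hμ : IsLogConcaveMeasure μ) (k l m n : ℕ) :
    IsBerwaldBorellTransform k l m n μ ν ↔
      ν + (powerWeighted k μ).conv (powerWeighted n μ) =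
        (powerWeighted l μ).conv (powerWeighted m μ) := by
  have fA := hμ.isFiniteMeasure_conv l m
  have fB := hμ.isFiniteMeasure_conv k n
  have zA := hμ.conv_Iio_eq_zero l m
  have zB := hμ.conv_Iio_eq_zero k n
  constructor
  · intro h
    have := h.finite
    have zs : (ν + (powerWeighted k μ).conv (powerWeighted n μ)) (Iio 0) = 0 := by
      simp [h.supported, zB]
    refine measure_ext_of_laplace zs zA fun t ht => ?_
    rw [restrict_Ici_eq_self zs, restrict_Ici_eq_self zA,
      integral_add_measure (integrable_exp_neg_mul h.supported ht.le)
        (integrable_exp_neg_mul zB ht.le), hμ.laplace_conv, hμ.laplace_conv]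
    have hl := h.laplace_eq t ht
    rw [restrict_Ici_eq_self h.supported] at hl
    rw [hl, sub_add_cancel]
  · intro h
    have hle : ν ≤ (powerWeighted l μ).conv (powerWeighted m μ) := h ▸ Measure.le_add_right le_rfl
    have fν : IsFiniteMeasure ν := isFiniteMeasure_of_le _ hle
    have zν : ν (Iio 0) = 0 := le_antisymm ((hle _).trans zA.le) zero_le
    refine ⟨inferInstance, hμ, fν, zν, fun t ht => ?_⟩
    rw [restrict_Ici_eq_self zν, ← hμ.laplace_conv, ← hμ.laplace_conv, ← h,
      integral_add_measure (integrable_exp_neg_mul zν ht.le) (integrable_exp_neg_mul zB ht.le),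
      add_sub_cancel_right]

/-- Working with the measure identity instead of Laplace transforms makes the sign of t irrelevant:
finiteness of the tilted μ is all that is needed, and finiteness of the tilted ν comes out of the
characterisation. -/
theorem IsBerwaldBorellTransform.expTilt {k l m n : ℕ} {μ ν : Measure ℝ}
    (h : IsBerwaldBorellTransform k l m n μ ν) (t : ℝ)
    (ht : IsFiniteMeasure (_root_.expTilt t μ)) :
    IsBerwaldBorellTransform k l m n (_root_.expTilt t μ) (_root_.expTilt t ν) := by
  have := h.base_finite
  have hμ := h.base_logConcave
  rw [isBerwaldBorellTransform_iff (hμ.expTilt t), ← hμ.expTilt_conv, ← hμ.expTilt_conv,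
    ← expTilt_add_measure, (isBerwaldBorellTransform_iff hμ k l m n).1 h]

theorem mainTheorem11 (μ : Measure ℝ) (hfin : IsFiniteMeasure μ) (hμ : IsLogConcaveMeasure μ)
    (k l m n : ℕ) (hkl : k ≤ l) (hlm : l ≤ m) (hmn : m ≤ n) (hsum : k + n = l + m) :
    (∃! ν : Measure ℝ, IsBerwaldBorellTransform k l m n μ ν) ∧
    ∀ ν : Measure ℝ, IsBerwaldBorellTransform k l m n μ ν →
      (∃ (_ : IsFiniteMeasure ν)
          (_ : IsFiniteMeasure ((powerWeighted l μ).conv (powerWeighted m μ)))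
          (_ : IsFiniteMeasure ((powerWeighted k μ).conv (powerWeighted n μ))),
        ν.toSignedMeasure =
          ((powerWeighted l μ).conv (powerWeighted m μ)).toSignedMeasure -
            ((powerWeighted k μ).conv (powerWeighted n μ)).toSignedMeasure) ∧
      (∀ t : ℝ, 0 < t →
        IsBerwaldBorellTransform k l m n (expTilt t μ) (expTilt t ν)) ∧
      (∀ t : ℝ, IsFiniteMeasure (expTilt t μ) →
        IsBerwaldBorellTransform k l m n (expTilt t μ) (expTilt t ν)) := by
  have iff := fun ν => isBerwaldBorellTransform_iff (ν := ν) hμ k l m n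
  have fA := hμ.isFiniteMeasure_conv l m
  have fB := hμ.isFiniteMeasure_conv k n
  have hle := hμ.powerWeighted_conv_le hkl hlm hsum
  -- The witness is the truncated difference of measures, which is a genuine difference because of
  -- `hle`.
  refine ⟨⟨_, (iff _).2 (Measure.sub_add_cancel_of_le hle), fun ν hν => ?_⟩, fun ν hν => ?_⟩
  · rw [← (iff ν).1 hν, Measure.add_sub_cancel]
  · have fν := hν.finite
    refine ⟨⟨fν, fA, fB, ?_⟩,
      fun t ht => hν.expTilt t (isFiniteMeasure_expTilt hμ.Iio_eq_zero ht.le),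
      fun t ht => hν.expTilt t ht⟩
    rw [eq_sub_iff_add_eq, ← Measure.toSignedMeasure_add]
    exact Measure.toSignedMeasure_congr ((iff ν).1 hν)
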